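/- Let $\mathbb R\langle x\rangle$ be the ring of polynomials over $\mathbb R$ in $g$ freely noncommuting variables $x=(x_1,\dots,x_g)$, with the involution $*$ determined by $x_j^*=x_j$, $(pq)^*=q^*p^*$ and real linearity. Call $p$ symmetric if $p^*=p$. Let $\mathbb S_n$ be the set of real symmetric $n\times n$ matrices and $\mathbb S_n(\mathbb R^g)$ the set of $g$-tuples $X=(X_1,\dots,X_g)$ of such matrices; $p(X)$ denotes the matrix obtained by substituting $X_j$ for $x_j$, and $p(0)\in\mathbb R$ denotes the constant term of $p$. For $A\in\mathbb S_n$ put $$\mathcal D_p(A)=\{X\in\mathbb S_n(\mathbb R^g): A-p(X)\succ 0\}.$$ A linear polynomial is a real linear combination of $x_1,\dots,x_g$. A sum of squares is a polynomial of the form $\sum_{j=1}^m h_j^*h_j$ with $h_j\in\mathbb R\langle x\rangle$. A symmetric polynomial $q$ is quasi-convex if $q(0)=0$ and, for each $n$ and each positive definite $A\in\mathbb S_n$, the set $\mathcal D_q(A)$ is convex. A symmetric polynomial $q$ is matrix convex if $q(tX+(1-t)Y)\preceq t\,q(X)+(1-t)\,q(Y)$ for each $n$, all $X,Y\in\mathbb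 S_n(\mathbb R^g)$ and all $0\le t\le 1$. Theorem. For a symmetric polynomial $p\in\mathbb R\langle x\rangle$ the following are equivalent: (i) there are a linear polynomial $\ell$ and finitely many linear polynomials $s_j$ such that $p-p(0)=\ell+\sum_j s_j^*s_j$; (ii) $p$ is matrix convex; (iii) $\mathcal D_p(A)$ is convex for every $n$ and every $A\in\mathbb S_n$; (iv) $p-p(0)$ is quasi-convex and $p(0)-p$ is not a nonzero sum of squares. -/

import Mathlib

/-- Real polynomials in `g` freely noncommuting variables. Mathlib's `star` on this ring is the
involution that fixes the scalars and the variables and reverses products. -/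
abbrev FreePoly (g : ℕ) : Type := FreeAlgebra ℝ (Fin g)

namespace FreePoly

/-- Evaluation `p(X)` at a tuple of real `n × n` matrices: the algebra homomorphism `x_j ↦ X_j`. -/
noncomputable def eval {g n : ℕ} (p : FreePoly g) (X : Fin g → Matrix (Fin n) (Fin n) ℝ) :
    Matrix (Fin n) (Fin n) ℝ :=
  FreeAlgebra.lift ℝ X p

/-- The constant term of `p`, that is, its value at `0 ∈ ℝ^g` (the coefficient of the empty
word). -/
noncomputable def constTerm {g : ℕ} (p : FreePoly g) : ℝ :=
  FreeAlgebra.lift ℝ (0 : Fin g → ℝ) p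

/-- The polynomial `p - p(0)`. -/
noncomputable def centered {g : ℕ} (p : FreePoly g) : FreePoly g :=
  p - algebraMap ℝ (FreePoly g) (constTerm p)

/-- `p` is symmetric: `p* = p`. -/
def Symmetric {g : ℕ} (p : FreePoly g) : Prop :=
  star p = p

/-- `p` is linear (homogeneous of degree one, or zero): a linear combination of the variables. -/
def IsLinear {g : ℕ} (p : FreePoly g) : Prop :=
  p ∈ Submodule.span ℝ (Set.range (FreeAlgebra.ι ℝ : Fin g → FreePoly g))

/-- `p` is a hermitian sum of squares `∑ h_j* h_j` of free polynomials. -/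
def IsSumSq {g : ℕ} (p : FreePoly g) : Prop :=
  ∃ (m : ℕ) (h : Fin m → FreePoly g), p = ∑ j, star (h j) * h j

/-- `p = ℓ + ∑ s_j* s_j` with `ℓ` and all `s_j` linear. -/
def IsLinearPlusSumSqLinear {g : ℕ} (p : FreePoly g) : Prop :=
  ∃ (l : FreePoly g) (m : ℕ) (s : Fin m → FreePoly g),
    IsLinear l ∧ (∀ j, IsLinear (s j)) ∧ p = l + ∑ j, star (s j) * s j

/-- The set `𝒟(A)` of `g`-tuples `X` of symmetric `n × n` matrices with `A - p(X) ≻ 0`. -/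
def sublevel {g n : ℕ} (p : FreePoly g) (A : Matrix (Fin n) (Fin n) ℝ) :
    Set (Fin g → Matrix (Fin n) (Fin n) ℝ) :=
  {X | (∀ j, (X j).IsSymm) ∧ (A - eval p X).PosDef}

/-- `p` is quasi-convex: it is symmetric, `p(0) = 0`, and `𝒟(A)` is convex for every positive
definite `A` of every size. -/
def QuasiConvex {g : ℕ} (p : FreePoly g) : Prop :=
  Symmetric p ∧ constTerm p = 0 ∧
    ∀ (n : ℕ) (A : Matrix (Fin n) (Fin n) ℝ), A.PosDef → Convex ℝ (sublevel p A)

/-- `p` is matrix convex: it is symmetric and `p(tX + (1-t)Y) ⪯ t p(X) + (1-t) p(Y)` for all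
tuples of symmetric matrices `X`, `Y` of equal size and all `0 ≤ t ≤ 1`. -/
def MatrixConvex {g : ℕ} (p : FreePoly g) : Prop :=
  Symmetric p ∧
    ∀ (n : ℕ) (X Y : Fin g → Matrix (Fin n) (Fin n) ℝ) (t : ℝ),
      (∀ j, (X j).IsSymm) → (∀ j, (Y j).IsSymm) → 0 ≤ t → t ≤ 1 →
        (t • eval p X + (1 - t) • eval p Y - eval p (t • X + (1 - t) • Y)).PosSemidef

end FreePoly

/-!
Suppose that the sublevel sets of `p` at positive definite levels are convex and that `p` takes a
value that is not negative semidefinite. Finsler's lemma turns a scalar bound on `⟨p(X) v, v⟩` and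
`⟨p(Y) v, v⟩` into a matrix level `A` above `p(X)` and `p(Y)`, so that the forms `⟨p(·) v, v⟩` have
convex sublevel sets. Applied to `X ⊕ Y` and `Y ⊕ X`, which share their value at `v ⊕ v`, this
improves to midpoint convexity: the defect `½ p(x + y) + ½ p(x - y) - p(x)` is positive
semidefinite at all tuples of symmetric matrices. By Helton's theorem (separation from the cone of
sums of squares, and the GNS construction) it is a sum of squares. The words `x_w y_i y_j x_u` have
the same coefficient in the defect as `x_w x_i x_j x_u` in `p`, while words in `x` alone have
coefficient zero; as top-degree terms cannot cancel in a sum of squares, `p` has degree at most two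
and its quadratic part is a sum of squares of linear polynomials.

A constant can be added to `p` to create a positive value when all levels `A` are allowed. When
only positive definite ones are and `p` is negative semidefinite everywhere, `-p` is a sum of
squares by Helton's theorem. Conversely, the convexity gap of `ℓ + ∑ sⱼ* sⱼ` is
`t (1 - t) ∑ (sⱼ(X) - sⱼ(Y))²`.
-/

open Matrix Set Filter Topology

namespace FreePoly

section Words

variable {R σ : Type*} [CommSemiring R]

/-- The monomial `x_{w₁} ⋯ x_{w_k}` of a word `w`. -/
noncomputable def word (R : Type*) {σ : Type*} [CommSemiring R] (w : List σ) : FreeAlgebra R σ :=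
  (w.map (FreeAlgebra.ι R)).prod

@[simp] theorem word_nil : word R ([] : List σ) = 1 := rfl

@[simp] theorem word_cons (j : σ) (w : List σ) :
    word R (j :: w) = FreeAlgebra.ι R j * word R w := by
  simp [word]

theorem word_append (u w : List σ) : word R (u ++ w) = word R u * word R w := by
  simp [word]

theorem star_word (w : List σ) : star (word R w) = word R w.reverse := by
  induction w with
  | nil => simp
  | cons j w ih => simp [ih, word_append]

/-- The basis of `R⟨x⟩` consisting of the words. -/
noncomputable def wordBasis (R σ : Type*) [CommSemiring R] :
    Module.Basis (List σ) R (FreeAlgebra R σ) :=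
  (FreeAlgebra.basisFreeMonoid R σ).reindex FreeMonoid.toList

@[simp] theorem wordBasis_apply (w : List σ) : wordBasis R σ w = word R w := by
  have hword : FreeAlgebra.equivMonoidAlgebraFreeMonoid (word R w)
      = MonoidAlgebra.of R (FreeMonoid σ) (FreeMonoid.ofList w) := by
    induction w with
    | nil => simp; rfl
    | cons j w ih =>
      rw [word_cons, map_mul, ih, FreeMonoid.ofList_cons, map_mul]
      simp [FreeAlgebra.equivMonoidAlgebraFreeMonoid]
  simp only [wordBasis, Module.Basis.reindex_apply, FreeAlgebra.basisFreeMonoid,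
    Module.Basis.map_apply, Finsupp.coe_basisSingleOne]
  rw [LinearEquiv.symm_apply_eq, LinearEquiv.trans_apply, AlgEquiv.toLinearEquiv_apply, hword]
  rfl

/-- The coefficient of the word `w`. -/
noncomputable def coeff (w : List σ) : FreeAlgebra R σ →ₗ[R] R :=
  (wordBasis R σ).coord w

theorem coeff_word [DecidableEq σ] (u w : List σ) :
    coeff u (word R w) = if u = w then 1 else 0 := by
  rw [← wordBasis_apply, coeff, Module.Basis.coord_apply, Module.Basis.repr_self,
    Finsupp.single_apply]
  simp only [eq_comm]

theorem coeff_one (w : List σ) : coeff w (1 : FreeAlgebra R σ) = if w = [] then 1 else 0 := by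
  classical
  simpa using coeff_word (R := R) w []

theorem coeff_ι [DecidableEq σ] (w : List σ) (j : σ) :
    coeff w (FreeAlgebra.ι R j) = if w = [j] then 1 else 0 := by
  simpa using coeff_word (R := R) w [j]

theorem coeff_ext {p q : FreeAlgebra R σ} (h : ∀ w, coeff w p = coeff w q) : p = q :=
  (wordBasis R σ).ext_elem h

theorem linearMap_ext_word {M : Type*} [AddCommMonoid M] [Module R M]
    {f f' : FreeAlgebra R σ →ₗ[R] M} (h : ∀ w, f (word R w) = f' (word R w)) : f = f' :=
  (wordBasis R σ).ext fun w => by simpa using h w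

theorem star_smul_free (c : R) (p : FreeAlgebra R σ) : star (c • p) = c • star p := by
  rw [Algebra.smul_def, star_mul, FreeAlgebra.star_algebraMap, ← Algebra.commutes,
    ← Algebra.smul_def]

/-- The involution of `R⟨x⟩` as a linear map. -/
noncomputable def starLinear (R σ : Type*) [CommSemiring R] :
    FreeAlgebra R σ →ₗ[R] FreeAlgebra R σ where
  toFun := star
  map_add' := star_add
  map_smul' := star_smul_free

theorem coeff_star (w : List σ) (p : FreeAlgebra R σ) : coeff w (star p) = coeff w.reverse p := by
  classical
  have h : coeff w ∘ₗ starLinear R σ = coeff w.reverse := linearMap_ext_word fun u => by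
    change coeff w (star (word R u)) = _
    simp only [star_word, coeff_word, List.reverse_eq_iff]
  exact LinearMap.congr_fun h p

theorem coeff_nil (p : FreeAlgebra R σ) :
    coeff [] p = FreeAlgebra.lift R (0 : σ → R) p := by
  classical
  have h : coeff [] = (FreeAlgebra.lift R (0 : σ → R)).toLinearMap := linearMap_ext_word fun w => by
    rw [coeff_word, AlgHom.toLinearMap_apply, word, map_list_prod]
    cases w <;> simp
  exact LinearMap.congr_fun h p

theorem coeff_mul (w : List σ) (p q : FreeAlgebra R σ) :
    coeff w (p * q)
      = ∑ i ∈ Finset.range (w.length + 1), coeff (w.take i) p * coeff (w.drop i) q := by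
  classical
  have h : (LinearMap.mul R (FreeAlgebra R σ)).compr₂ (coeff w) =
      ∑ i ∈ Finset.range (w.length + 1),
        (LinearMap.mul R R).compl₁₂ (coeff (w.take i)) (coeff (w.drop i)) := by
    refine linearMap_ext_word fun u => linearMap_ext_word fun v => ?_
    have hsplit : ∀ i ∈ Finset.range (w.length + 1),
        ((if w.take i = u then 1 else 0) * (if w.drop i = v then 1 else 0) : R)
          = if i = u.length then if w = u ++ v then 1 else 0 else 0 := by
      intro i hi
      have hi : i ≤ w.length := by simpa [Nat.lt_succ_iff] using hi
      rw [← ite_and, ite_zero_mul_ite_zero, mul_one]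
      refine if_congr ⟨?_, ?_⟩ rfl rfl
      · rintro ⟨rfl, rfl⟩
        simp [hi]
      · rintro ⟨rfl, rfl⟩
        simp
    have hlen : w = u ++ v → u.length < w.length + 1 := by
      rintro rfl
      simp
    simp only [LinearMap.compr₂_apply, LinearMap.mul_apply', ← word_append, LinearMap.sum_apply,
      LinearMap.compl₁₂_apply, coeff_word, Finset.sum_congr rfl hsplit, Finset.sum_ite_eq',
      Finset.mem_range]
    split_ifs with hw hlt
    · rfl
    · exact absurd (hlen hw) hlt
    all_goals rfl
  simpa [LinearMap.sum_apply] using LinearMap.congr_fun₂ h p q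

end Words

section Degree

variable {R σ : Type*} [CommSemiring R]

/-- The polynomials of degree less than `N`. -/
noncomputable def degreeLT (R σ : Type*) [CommSemiring R] (N : ℕ) :
    Submodule R (FreeAlgebra R σ) :=
  Submodule.span R (word R '' {w | w.length < N})

theorem mem_degreeLT {N : ℕ} {p : FreeAlgebra R σ} :
    p ∈ degreeLT R σ N ↔ ∀ w : List σ, N ≤ w.length → coeff w p = 0 := by
  have hword : word R = wordBasis R σ := funext fun w => (wordBasis_apply w).symm
  rw [degreeLT, hword, Module.Basis.mem_span_image]
  refine forall_congr' fun w => ?_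
  rw [SetLike.mem_coe, Finsupp.mem_support_iff, mem_ofPred_eq, not_imp_comm, not_lt]
  rfl

theorem word_mem_degreeLT {N : ℕ} {w : List σ} (hw : w.length < N) :
    word R w ∈ degreeLT R σ N :=
  Submodule.subset_span ⟨w, hw, rfl⟩

theorem degreeLT_mono : Monotone (degreeLT R σ) := fun _ _ hMN =>
  Submodule.span_mono (image_mono fun _ hw => lt_of_lt_of_le hw hMN)

theorem exists_mem_degreeLT (p : FreeAlgebra R σ) : ∃ N, p ∈ degreeLT R σ N := by
  refine ⟨((wordBasis R σ).repr p).support.sup List.length + 1, mem_degreeLT.2 fun w hw => ?_⟩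
  by_contra hne
  have : w.length ≤ ((wordBasis R σ).repr p).support.sup List.length :=
    Finset.le_sup (f := List.length) (Finsupp.mem_support_iff.2 hne)
  omega

instance [Finite σ] (N : ℕ) : Module.Finite R (degreeLT R σ N) :=
  Module.Finite.span_of_finite R ((List.finite_length_lt σ N).image _)

theorem mul_mem_degreeLT {M N : ℕ} {p q : FreeAlgebra R σ} (hp : p ∈ degreeLT R σ (M + 1))
    (hq : q ∈ degreeLT R σ N) : p * q ∈ degreeLT R σ (M + N) := by
  rw [mem_degreeLT] at *
  intro w hw
  rw [coeff_mul]
  refine Finset.sum_eq_zero fun i hi => ?_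
  have hi : i ≤ w.length := by simpa [Nat.lt_succ_iff] using hi
  rcases lt_or_ge M i with hM | hM
  · rw [hp _ (by simpa [hi] using hM), zero_mul]
  · rw [hq _ (by rw [List.length_drop]; omega), mul_zero]

theorem star_mem_degreeLT {N : ℕ} {p : FreeAlgebra R σ} (hp : p ∈ degreeLT R σ N) :
    star p ∈ degreeLT R σ N :=
  mem_degreeLT.2 fun w hw => by
    rw [coeff_star, mem_degreeLT.1 hp _ (by simpa using hw)]

theorem sum_star_mul_self_mem_degreeLT {ι : Type*} [Fintype ι] {h : ι → FreeAlgebra R σ} {N : ℕ}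
    (hh : ∀ k, h k ∈ degreeLT R σ (N + 1)) :
    ∑ k, star (h k) * h k ∈ degreeLT R σ (N + (N + 1)) :=
  Submodule.sum_mem _ fun k _ => mul_mem_degreeLT (star_mem_degreeLT (hh k)) (hh k)

theorem coeff_append_mul {u v : List σ} {p q : FreeAlgebra R σ}
    (hp : p ∈ degreeLT R σ (u.length + 1)) (hq : q ∈ degreeLT R σ (v.length + 1)) :
    coeff (u ++ v) (p * q) = coeff u p * coeff v q := by
  rw [mem_degreeLT] at hp hq
  rw [coeff_mul, Finset.sum_eq_single u.length]
  · simp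
  · intro i hi hne
    have hi : i ≤ u.length + v.length := by simpa [Nat.lt_succ_iff] using hi
    rcases lt_or_gt_of_ne hne with hlt | hgt
    · rw [hq _ (by simp only [List.length_drop, List.length_append]; omega), mul_zero]
    · rw [hp _ (by simp only [List.length_take, List.length_append]; omega), zero_mul]
  · simp

theorem coeff_append_sum_star_mul_self {ι : Type*} [Fintype ι] {h : ι → FreeAlgebra R σ}
    {u v : List σ} (huv : u.length = v.length) (hh : ∀ k, h k ∈ degreeLT R σ (v.length + 1)) :
    coeff (u.reverse ++ v) (∑ k, star (h k) * h k) = ∑ k, coeff u (h k) * coeff v (h k) := by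
  rw [map_sum]
  refine Finset.sum_congr rfl fun k _ => ?_
  rw [coeff_append_mul (by simpa [huv] using star_mem_degreeLT (hh k)) (hh k), coeff_star,
    List.reverse_reverse]

end Degree

section Descent

variable {R σ ι : Type*} [CommRing R] [LinearOrder R] [IsStrictOrderedRing R] [Fintype ι]

/- The top-degree coefficients of the `h k` cannot cancel in `∑ star (h k) * h k`: the
coefficient of `u.reverse ++ u` is a sum of squares in `R`. -/
theorem mem_degreeLT_of_coeff_sum_star_mul_self {h : ι → FreeAlgebra R σ} {n : ℕ}
    (hdiag : ∀ u : List σ, n ≤ u.length → (∀ k, h k ∈ degreeLT R σ (u.length + 1)) →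
      coeff (u.reverse ++ u) (∑ k, star (h k) * h k) = 0) (k : ι) :
    h k ∈ degreeLT R σ n := by
  have descend : ∀ N, n ≤ N → (∀ k, h k ∈ degreeLT R σ N) → ∀ k, h k ∈ degreeLT R σ n := by
    intro N hN
    induction N, hN using Nat.le_induction with
    | base => exact id
    | succ m hm ih =>
      refine fun hh => ih fun k => mem_degreeLT.2 fun u hu => ?_
      rcases hu.eq_or_lt with rfl | hlt
      · have hsq := hdiag u hm hh
        rw [coeff_append_sum_star_mul_self rfl hh, Finset.sum_mul_self_eq_zero_iff] at hsq
        exact hsq k (Finset.mem_univ k)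
      · exact mem_degreeLT.1 (hh k) u hlt
  choose d hd using fun k => exists_mem_degreeLT (h k)
  refine descend (Finset.univ.sup d + n) (Nat.le_add_left _ _) (fun k => ?_) k
  exact degreeLT_mono ((Finset.le_sup (Finset.mem_univ k)).trans (Nat.le_add_right _ _)) (hd k)

theorem eq_zero_of_coeff_sum_star_mul_self {h : ι → FreeAlgebra R σ}
    (hdiag : ∀ u : List σ, coeff (u.reverse ++ u) (∑ k, star (h k) * h k) = 0) (k : ι) :
    h k = 0 := by
  have hk := mem_degreeLT_of_coeff_sum_star_mul_self (n := 0) (fun u _ _ => hdiag u) k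
  exact coeff_ext fun w => by simpa using mem_degreeLT.1 hk w (Nat.zero_le _)

theorem eq_zero_of_sum_star_mul_self_eq_zero {h : ι → FreeAlgebra R σ}
    (hsum : ∑ k, star (h k) * h k = 0) (k : ι) : h k = 0 :=
  eq_zero_of_coeff_sum_star_mul_self (fun u => by rw [hsum, map_zero]) k

end Descent

section Evaluation

variable {R σ : Type*} [CommSemiring R]

theorem map_lift {A B : Type*} [Semiring A] [Algebra R A] [Semiring B] [Algebra R B]
    (φ : A →ₐ[R] B) (X : σ → A) (p : FreeAlgebra R σ) :
    φ (FreeAlgebra.lift R X p) = FreeAlgebra.lift R (φ ∘ X) p := by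
  have h : φ.comp (FreeAlgebra.lift R X) = FreeAlgebra.lift R (φ ∘ X) :=
    FreeAlgebra.hom_ext (by ext j; simp)
  exact DFunLike.congr_fun h p

variable {κ μ : Type*} [Fintype κ] [DecidableEq κ] [Fintype μ] [DecidableEq μ]

theorem lift_star {X : σ → Matrix κ κ R} (hX : ∀ j, (X j).IsSymm) (p : FreeAlgebra R σ) :
    FreeAlgebra.lift R X (star p) = (FreeAlgebra.lift R X p)ᵀ := by
  induction p with
  | grade0 r => simp [Matrix.algebraMap_eq_diagonal, Matrix.diagonal_transpose]
  | grade1 j => simpa using (hX j).symm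
  | mul a b ha hb => rw [star_mul, map_mul, ha, hb, map_mul, transpose_mul]
  | add a b ha hb => rw [star_add, map_add, ha, hb, map_add, transpose_add]

theorem lift_isSymm {X : σ → Matrix κ κ R} (hX : ∀ j, (X j).IsSymm) {p : FreeAlgebra R σ}
    (hp : star p = p) : (FreeAlgebra.lift R X p).IsSymm := by
  rw [IsSymm, ← lift_star hX, hp]

theorem lift_reindex (e : κ ≃ μ) (X : σ → Matrix κ κ R) (p : FreeAlgebra R σ) :
    FreeAlgebra.lift R (fun j => (X j).submatrix e.symm e.symm) p
      = (FreeAlgebra.lift R X p).submatrix e.symm e.symm :=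
  (map_lift (reindexAlgEquiv R R e).toAlgHom X p).symm

end Evaluation

section GNS

variable {σ ι : Type*} (L : FreeAlgebra ℝ σ →ₗ[ℝ] ℝ) (e : ι → FreeAlgebra ℝ σ)

/-- The coordinate vector of `p` with respect to a family `e` that is orthonormal for the inner
product `(a, b) ↦ L (a* b)`. -/
def gnsVec : FreeAlgebra ℝ σ →ₗ[ℝ] ι → ℝ :=
  LinearMap.pi fun i => L ∘ₗ LinearMap.mulLeft ℝ (star (e i))

/-- The matrix, with respect to a family `e` that is orthonormal for the inner product
`(a, b) ↦ L (a* b)`, of left multiplication by `x_j` followed by orthogonal projection. -/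
def gnsMatrix (j : σ) : Matrix ι ι ℝ :=
  Matrix.of fun i k => L (star (e i) * FreeAlgebra.ι ℝ j * e k)

variable {L e}

theorem gnsVec_apply (p : FreeAlgebra ℝ σ) (i : ι) : gnsVec L e p i = L (star (e i) * p) := rfl

theorem gnsMatrix_isSymm (hL : ∀ p, L (star p) = L p) (j : σ) : (gnsMatrix L e j).IsSymm := by
  ext i k
  rw [transpose_apply, gnsMatrix, Matrix.of_apply, Matrix.of_apply, ← hL]
  simp [mul_assoc]

variable [Fintype ι]

theorem gnsMatrix_mulVec {p : FreeAlgebra ℝ σ} (hp : p = ∑ k, gnsVec L e p k • e k) (j : σ) :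
    gnsMatrix L e j *ᵥ gnsVec L e p = gnsVec L e (FreeAlgebra.ι ℝ j * p) := by
  ext i
  have hexpand : L (star (e i) * (FreeAlgebra.ι ℝ j * p))
      = ∑ k, gnsVec L e p k * L (star (e i) * (FreeAlgebra.ι ℝ j * e k)) := by
    conv_lhs => rw [hp]
    simp only [Finset.mul_sum, mul_smul_comm, map_sum, map_smul, smul_eq_mul]
  rw [gnsVec_apply, hexpand]
  simp only [mulVec, dotProduct, gnsMatrix, Matrix.of_apply, mul_assoc, mul_comm]

theorem gnsVec_dotProduct (hL : ∀ p, L (star p) = L p) (a : FreeAlgebra ℝ σ)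
    {p : FreeAlgebra ℝ σ} (hp : p = ∑ k, gnsVec L e p k • e k) :
    gnsVec L e a ⬝ᵥ gnsVec L e p = L (star a * p) := by
  conv_rhs => rw [hp]
  simp only [Finset.mul_sum, mul_smul_comm, map_sum, map_smul, smul_eq_mul, dotProduct]
  refine Finset.sum_congr rfl fun k _ => ?_
  rw [mul_comm, gnsVec_apply a, ← hL]
  simp

theorem lift_gnsMatrix_mulVec_one [DecidableEq ι] {N : ℕ}
    (he : ∀ p ∈ degreeLT ℝ σ N, p = ∑ k, gnsVec L e p k • e k) {p : FreeAlgebra ℝ σ}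
    (hp : p ∈ degreeLT ℝ σ N) :
    FreeAlgebra.lift ℝ (gnsMatrix L e) p *ᵥ gnsVec L e 1 = gnsVec L e p := by
  have hword : ∀ w : List σ, w.length < N →
      FreeAlgebra.lift ℝ (gnsMatrix L e) (word ℝ w) *ᵥ gnsVec L e 1 = gnsVec L e (word ℝ w) := by
    intro w
    induction w with
    | nil => simp
    | cons j w ih =>
      intro hw
      have hw : w.length < N := (Nat.lt_succ_self _).trans hw
      rw [word_cons, map_mul, FreeAlgebra.lift_ι_apply, ← mulVec_mulVec, ih hw,
        gnsMatrix_mulVec (he _ (word_mem_degreeLT hw))]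
  induction hp using Submodule.span_induction with
  | mem _ h =>
    obtain ⟨w, hw, rfl⟩ := h
    exact hword w hw
  | zero => simp
  | add a b _ _ ha hb => rw [map_add, add_mulVec, ha, hb, map_add]
  | smul c a _ ha => rw [map_smul, smul_mulVec, ha, map_smul]

theorem exists_orthonormal_expansion {V : Submodule ℝ (FreeAlgebra ℝ σ)} [FiniteDimensional ℝ V]
    (hL : ∀ p, L (star p) = L p) (hpos : ∀ h ∈ V, h ≠ 0 → 0 < L (star h * h)) :
    ∃ (n : ℕ) (e : Fin n → FreeAlgebra ℝ σ), ∀ p ∈ V, p = ∑ k, gnsVec L e p k • e k := by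
  let core : InnerProductSpace.Core ℝ V :=
    { inner := fun a b => L (star (a : FreeAlgebra ℝ σ) * b)
      conj_inner_symm := fun a b => by rw [conj_trivial, ← hL, star_mul, star_star]
      re_inner_nonneg := fun a => by
        rcases eq_or_ne (a : FreeAlgebra ℝ σ) 0 with ha | ha
        · simp [ha]
        · exact (hpos a a.2 ha).le
      add_left := fun a b c => by simp [add_mul]
      smul_left := fun a b c => by simp [star_smul_free]
      definite := fun a ha => by
        by_contra hne
        exact (hpos a a.2 (Submodule.coe_eq_zero.not.2 hne)).ne' ha }
  let _ : NormedAddCommGroup V := core.toNormedAddCommGroup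
  let _ : InnerProductSpace ℝ V := InnerProductSpace.ofCore core.toCore
  let b := stdOrthonormalBasis ℝ V
  refine ⟨_, fun k => b k, fun p hp => ?_⟩
  have hrepr := congrArg Subtype.val (b.sum_repr' ⟨p, hp⟩)
  rw [Submodule.coe_sum] at hrepr
  exact hrepr.symm

/-- `p` takes positive semidefinite values at all tuples of real symmetric matrices. -/
def MatrixPositive (p : FreeAlgebra ℝ σ) : Prop :=
  ∀ (n : ℕ) (X : σ → Matrix (Fin n) (Fin n) ℝ), (∀ j, (X j).IsSymm) →
    (FreeAlgebra.lift ℝ X p).PosSemidef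

theorem MatrixPositive.pos_of_forall_pos [Finite σ] {p : FreeAlgebra ℝ σ}
    (hpsd : MatrixPositive p) (hp0 : p ≠ 0) {N : ℕ} (hp : p ∈ degreeLT ℝ σ N)
    (hL : ∀ p, L (star p) = L p) (hpos : ∀ h ∈ degreeLT ℝ σ N, h ≠ 0 → 0 < L (star h * h)) :
    0 < L p := by
  obtain ⟨n, e, he⟩ := exists_orthonormal_expansion hL hpos
  have hdot : gnsVec L e 1 ⬝ᵥ gnsVec L e p = L p := by
    rw [gnsVec_dotProduct hL _ (he p hp), star_one, one_mul]
  have hX := hpsd n (gnsMatrix L e) (gnsMatrix_isSymm hL)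
  rw [← lift_gnsMatrix_mulVec_one he hp] at hdot
  refine lt_of_le_of_ne (hdot ▸ hX.dotProduct_mulVec_nonneg _) fun hzero => ?_
  have hkernel := (hX.dotProduct_mulVec_zero_iff (gnsVec L e 1)).1 (hdot.trans hzero.symm)
  rw [lift_gnsMatrix_mulVec_one he hp] at hkernel
  have hnorm := gnsVec_dotProduct hL p (he p hp)
  rw [hkernel, dotProduct_zero] at hnorm
  exact (hpos p hp hp0).ne hnorm

end GNS

section Separation

variable {E : Type*}

theorem mem_convexHull_iff_exists_fin_finrank [AddCommGroup E] [Module ℝ E] [FiniteDimensional ℝ E]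
    {s : Set E} (hs : s.Nonempty) {x : E} :
    x ∈ convexHull ℝ s ↔ ∃ t ∈ stdSimplex ℝ (Fin (Module.finrank ℝ E + 1)),
      ∃ y : Fin (Module.finrank ℝ E + 1) → E, (∀ i, y i ∈ s) ∧ ∑ i, t i • y i = x := by
  constructor
  · intro hx
    obtain ⟨ι, _, z, w, hz, hind, hw, hw1, hwz⟩ := eq_pos_convex_span_of_mem_convexHull hx
    have hcard : Fintype.card ι ≤ Fintype.card (Fin (Module.finrank ℝ E + 1)) := by
      simpa using hind.card_le_finrank_succ.trans
        (Nat.succ_le_succ (Submodule.finrank_le _))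
    obtain ⟨f⟩ := Function.Embedding.nonempty_of_card_le hcard
    obtain ⟨y₀, hy₀⟩ := hs
    have hout : ∀ i ∉ range f, Function.extend f w 0 i = 0 := fun i hi =>
      Function.extend_apply' _ _ _ hi
    refine ⟨Function.extend f w 0, ⟨fun i => ?_, ?_⟩, Function.extend f z fun _ => y₀,
      fun i => ?_, ?_⟩
    · by_cases hi : i ∈ range f
      · obtain ⟨k, rfl⟩ := hi
        rw [f.injective.extend_apply]
        exact (hw k).le
      · rw [hout i hi]
    · rw [← hw1]
      exact (Fintype.sum_of_injective f f.injective w _ hout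
        fun k => (f.injective.extend_apply ..).symm).symm
    · by_cases hi : i ∈ range f
      · obtain ⟨k, rfl⟩ := hi
        rw [f.injective.extend_apply]
        exact hz (mem_range_self k)
      · rwa [Function.extend_apply' _ _ _ hi]
    · rw [← hwz]
      refine (Fintype.sum_of_injective f f.injective _ _ (fun i hi => ?_) fun k => ?_).symm
      · rw [hout i hi, zero_smul]
      · rw [f.injective.extend_apply, f.injective.extend_apply]
  · rintro ⟨t, ⟨ht, ht1⟩, y, hy, rfl⟩
    exact (convex_convexHull ℝ s).sum_mem (fun i _ => ht i) ht1
      fun i _ => subset_convexHull ℝ s (hy i)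

theorem isCompact_convexHull [NormedAddCommGroup E] [NormedSpace ℝ E] [FiniteDimensional ℝ E]
    {s : Set E} (hs : IsCompact s) : IsCompact (convexHull ℝ s) := by
  rcases s.eq_empty_or_nonempty with rfl | hne
  · simp
  have himage : convexHull ℝ s =
      (fun q : (Fin (Module.finrank ℝ E + 1) → ℝ) × (Fin (Module.finrank ℝ E + 1) → E) =>
        ∑ i, q.1 i • q.2 i) '' stdSimplex ℝ _ ×ˢ univ.pi fun _ => s := by
    ext x
    rw [mem_convexHull_iff_exists_fin_finrank hne]
    simp [and_assoc]
  rw [himage]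
  exact ((isCompact_stdSimplex ℝ _).prod (isCompact_univ_pi fun _ => hs)).image (by fun_prop)

theorem exists_strongDual_of_ray_disjoint [NormedAddCommGroup E] [NormedSpace ℝ E]
    {K : Set E} (hK : IsCompact K) (hconv : Convex ℝ K) {x : E}
    (hx : ∀ c : ℝ, 0 ≤ c → c • x ∉ K) :
    ∃ f : StrongDual ℝ E, (∀ y ∈ K, 0 < f y) ∧ f x ≤ 0 := by
  let ray : Set E := (fun c : ℝ => c • x) '' Ici 0
  have hray : Convex ℝ ray :=
    (convex_Ici 0).linear_image (LinearMap.toSpanSingleton ℝ E x)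
  have hclosed : IsClosed ray := isClosedMap_smul_left x _ isClosed_Ici
  have hdisj : Disjoint K ray := by
    rw [Set.disjoint_right]
    rintro _ ⟨c, hc, rfl⟩
    exact hx c hc
  obtain ⟨f, u, v, hKu, huv, hv⟩ :=
    geometric_hahn_banach_compact_closed hconv hK hray hclosed hdisj
  have hfray : ∀ c : ℝ, 0 ≤ c → v < c * f x := fun c hc => by
    simpa using hv _ ⟨c, hc, rfl⟩
  have hv0 : v < 0 := by simpa using hfray 0 le_rfl
  refine ⟨-f, fun y hy => ?_, ?_⟩
  · simpa using ((hKu y hy).trans huv).trans hv0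
  · by_contra! hneg
    have hneg : f x < 0 := by simpa using hneg
    have := hfray (v / f x) (div_nonneg_of_nonpos hv0.le hneg.le)
    rw [div_mul_cancel₀ _ hneg.ne] at this
    exact lt_irrefl _ this

end Separation

section Helton

section BilinearCone

variable {V E : Type*} [AddCommGroup V] [Module ℝ V] [AddCommGroup E] [Module ℝ E]

theorem smul_bilin_self (B : V →ₗ[ℝ] V →ₗ[ℝ] E) {c : ℝ} (hc : 0 ≤ c) (x : V) :
    c • B x x = B (√c • x) (√c • x) := by
  rw [map_smul, map_smul, LinearMap.smul_apply, smul_smul, Real.mul_self_sqrt hc]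

theorem exists_sum_bilin_self_of_mem_convexHull (B : V →ₗ[ℝ] V →ₗ[ℝ] E) {s : Set V} (hs : 0 ∉ s)
    {y : E} (hy : y ∈ convexHull ℝ ((fun x => B x x) '' s)) :
    ∃ (n : ℕ) (x : Fin n → V), (∃ k, x k ≠ 0) ∧ ∑ k, B (x k) (x k) = y := by
  obtain ⟨ι, _, w, z, hw, hw1, hz, rfl⟩ := mem_convexHull_iff_exists_fintype.1 hy
  choose x hx hxz using hz
  let e := (Fintype.equivFin ι).symm
  refine ⟨_, fun k => √(w (e k)) • x (e k), ?_, ?_⟩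
  · obtain ⟨i, -, hi⟩ := Finset.exists_ne_zero_of_sum_ne_zero (hw1.trans_ne one_ne_zero)
    refine ⟨e.symm i, smul_ne_zero ?_ fun h0 => hs (h0 ▸ hx _)⟩
    simpa using (Real.sqrt_pos.2 ((hw i).lt_of_ne' hi)).ne'
  · rw [← e.sum_comp]
    exact Finset.sum_congr rfl fun k _ => by rw [← smul_bilin_self B (hw _), ← hxz]

/- Separate the compact convex hull of the values of the form on the unit sphere from the ray
through `y`. -/
theorem exists_pos_of_ne_sum_bilin_self [FiniteDimensional ℝ V] [FiniteDimensional ℝ E]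
    (B : V →ₗ[ℝ] V →ₗ[ℝ] E)
    (hB : ∀ (n : ℕ) (x : Fin n → V), ∑ k, B (x k) (x k) = 0 → ∀ k, x k = 0)
    {y : E} (hy : ∀ (n : ℕ) (x : Fin n → V), ∑ k, B (x k) (x k) ≠ y) :
    ∃ f : E →ₗ[ℝ] ℝ, (∀ x, x ≠ 0 → 0 < f (B x x)) ∧ f y ≤ 0 := by
  let φ := (Module.finBasis ℝ V).equivFun
  let ψ := (Module.finBasis ℝ E).equivFun
  let _ : NormedAddCommGroup V := .induced V _ φ φ.injective
  let _ : NormedSpace ℝ V := .induced ℝ V _ φ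
  let _ : NormedAddCommGroup E := .induced E _ ψ ψ.injective
  let _ : NormedSpace ℝ E := .induced ℝ E _ ψ
  have hcont : Continuous fun x => B x x := by
    let B' : V →L[ℝ] V →L[ℝ] E :=
      LinearMap.toContinuousLinearMap (LinearMap.toContinuousLinearMap.toLinearMap ∘ₗ B)
    change Continuous fun x => B' x x
    fun_prop
  have : ProperSpace V := FiniteDimensional.proper ℝ V
  let K := convexHull ℝ ((fun x => B x x) '' Metric.sphere 0 1)
  have hK : IsCompact K := isCompact_convexHull ((isCompact_sphere 0 1).image hcont)
  have hray : ∀ c : ℝ, 0 ≤ c → c • y ∉ K := by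
    intro c hc hcy
    obtain ⟨n, x, ⟨k, hk⟩, hx⟩ := exists_sum_bilin_self_of_mem_convexHull B (by simp) hcy
    rcases hc.eq_or_lt with rfl | hc
    · exact hk (hB n x (by rw [hx, zero_smul]) k)
    · refine hy n (fun k => √c⁻¹ • x k) ?_
      simp only [← smul_bilin_self B (inv_nonneg.2 hc.le), ← Finset.smul_sum, hx,
        inv_smul_smul₀ hc.ne']
  obtain ⟨f, hfK, hfy⟩ := exists_strongDual_of_ray_disjoint hK (convex_convexHull ℝ _) hray
  refine ⟨f, fun x hx => ?_, hfy⟩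
  have hsphere : ‖x‖⁻¹ • x ∈ Metric.sphere (0 : V) 1 := by
    simp [norm_smul, hx]
  have hpos := hfK _ (subset_convexHull ℝ _ ⟨_, hsphere, rfl⟩)
  simp only [map_smul, LinearMap.smul_apply, smul_eq_mul] at hpos
  have hinv : 0 < ‖x‖⁻¹ := inv_pos.2 (norm_pos_iff.2 hx)
  exact (mul_pos_iff_of_pos_left hinv).1 ((mul_pos_iff_of_pos_left hinv).1 hpos)

end BilinearCone

variable {σ : Type*} [Finite σ]

theorem exists_star_mul_self_pos_of_ne_sum_star_mul_self {p : FreeAlgebra ℝ σ} {N : ℕ}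
    (hp : p ∈ degreeLT ℝ σ N)
    (hsos : ∀ (m : ℕ) (h : Fin m → FreeAlgebra ℝ σ), ∑ k, star (h k) * h k ≠ p) :
    ∃ L : FreeAlgebra ℝ σ →ₗ[ℝ] ℝ,
      (∀ h ∈ degreeLT ℝ σ N, h ≠ 0 → 0 < L (star h * h)) ∧ L p ≤ 0 := by
  let V := degreeLT ℝ σ N
  let W := degreeLT ℝ σ (N + N)
  obtain ⟨π, hπ⟩ := W.subtype.exists_leftInverse_of_injective W.ker_subtype
  have hπW : ∀ q ∈ W, (π q : FreeAlgebra ℝ σ) = q := fun q hq =>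
    congrArg Subtype.val (LinearMap.congr_fun hπ ⟨q, hq⟩)
  let B : V →ₗ[ℝ] V →ₗ[ℝ] W :=
    ((LinearMap.mul ℝ _).compl₁₂ (starLinear ℝ σ ∘ₗ V.subtype) V.subtype).compr₂ π
  have hB : ∀ (n : ℕ) (x : Fin n → V),
      ((∑ k, B (x k) (x k) : W) : FreeAlgebra ℝ σ) = ∑ k, star (x k : FreeAlgebra ℝ σ) * x k := by
    intro n x
    rw [Submodule.coe_sum]
    exact Finset.sum_congr rfl fun k _ =>
      hπW _ (mul_mem_degreeLT (degreeLT_mono N.le_succ (star_mem_degreeLT (x k).2)) (x k).2)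
  have hpW : p ∈ W := degreeLT_mono (Nat.le_add_right N N) hp
  obtain ⟨f, hf, hfp⟩ := exists_pos_of_ne_sum_bilin_self B (y := ⟨p, hpW⟩)
    (fun n x hx k => Subtype.ext (eq_zero_of_sum_star_mul_self_eq_zero
      (by rw [← hB, hx, Submodule.coe_zero]) k))
    (fun n x hx => hsos n _ (by rw [← hB, hx]))
  refine ⟨f ∘ₗ π, fun h hh h0 => hf ⟨h, hh⟩ fun h' => h0 (congrArg Subtype.val h'), ?_⟩
  rwa [LinearMap.comp_apply, show π p = ⟨p, hpW⟩ from Subtype.ext (hπW p hpW)]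

theorem MatrixPositive.exists_sum_star_mul_self {p : FreeAlgebra ℝ σ} (hpsd : MatrixPositive p)
    (hp : star p = p) :
    ∃ (m : ℕ) (h : Fin m → FreeAlgebra ℝ σ), p = ∑ k, star (h k) * h k := by
  by_contra! hsos
  obtain ⟨N, hN⟩ := exists_mem_degreeLT p
  obtain ⟨L, hL, hLp⟩ :=
    exists_star_mul_self_pos_of_ne_sum_star_mul_self hN fun m h => (hsos m h).symm
  have hp0 : p ≠ 0 := by simpa using hsos 0 Fin.elim0
  have hpos := hpsd.pos_of_forall_pos (L := L + L ∘ₗ starLinear ℝ σ) hp0 hN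
    (fun q => by
      change L (star q) + L (star (star q)) = L q + L (star q)
      rw [star_star, add_comm])
    (fun h hh h0 => by
      change 0 < L (star h * h) + L (star (star h * h))
      rw [star_mul, star_star]
      exact add_pos (hL h hh h0) (hL h hh h0))
  change 0 < L p + L (star p) at hpos
  rw [hp] at hpos
  linarith

end Helton

section MidpointDefect

variable {R σ : Type*} [CommSemiring R]

theorem coeff_nil_ι_mul (j : σ) (p : FreeAlgebra R σ) :
    coeff [] (FreeAlgebra.ι R j * p) = 0 := by
  simp [coeff_nil]

theorem coeff_cons_ι_mul [DecidableEq σ] (i j : σ) (w : List σ) (p : FreeAlgebra R σ) :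
    coeff (i :: w) (FreeAlgebra.ι R j * p) = if i = j then coeff w p else 0 := by
  have h : coeff (i :: w) ∘ₗ LinearMap.mulLeft R (FreeAlgebra.ι R j)
      = if i = j then coeff w else 0 := linearMap_ext_word fun u => by
    rw [LinearMap.comp_apply, LinearMap.mulLeft_apply, ← word_cons, coeff_word]
    by_cases hij : i = j <;> simp [hij, coeff_word]
  rw [← LinearMap.mulLeft_apply R, ← LinearMap.comp_apply, h]
  split_ifs <;> rfl

/-- The substitution `x ↦ x + b y`; the variables `x` and `y` are indexed by the left and the right
summand of `σ ⊕ σ`. -/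
noncomputable def shift (b : R) : FreeAlgebra R σ →ₐ[R] FreeAlgebra R (σ ⊕ σ) :=
  FreeAlgebra.lift R fun j => FreeAlgebra.ι R (.inl j) + b • FreeAlgebra.ι R (.inr j)

theorem coeff_shift (b : R) (w : List (σ ⊕ σ)) (p : FreeAlgebra R σ) :
    coeff w (shift b p) = b ^ w.countP Sum.isRight * coeff (w.map (Sum.elim id id)) p := by
  classical
  have h : coeff w ∘ₗ (shift b).toLinearMap
      = b ^ w.countP Sum.isRight • coeff (w.map (Sum.elim id id)) :=
    linearMap_ext_word fun u => by
      simp only [LinearMap.comp_apply, AlgHom.toLinearMap_apply, LinearMap.smul_apply]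
      induction u generalizing w with
      | nil => cases w <;> simp [coeff_one]
      | cons j u ih =>
        rw [word_cons, map_mul, shift, FreeAlgebra.lift_ι_apply, ← shift, add_mul, smul_mul_assoc,
          map_add, map_smul]
        rcases w with _ | ⟨i | i, w⟩
        · simp [coeff_nil_ι_mul]
        all_goals
          by_cases hij : i = j <;>
            simp [coeff_cons_ι_mul, ih, hij, List.countP_cons, pow_succ', mul_assoc]
  exact LinearMap.congr_fun h p

theorem lift_shift {A : Type*} [Semiring A] [Algebra R A] (Z : σ ⊕ σ → A) (b : R)
    (p : FreeAlgebra R σ) :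
    FreeAlgebra.lift R Z (shift b p) = FreeAlgebra.lift R (Z ∘ .inl + b • (Z ∘ .inr)) p := by
  rw [shift, map_lift]
  congr 2
  ext j
  simp

/-- The midpoint defect `½ p(x + y) + ½ p(x - y) - p(x)` of `p`. -/
noncomputable def midpointDefect (p : FreeAlgebra ℝ σ) : FreeAlgebra ℝ (σ ⊕ σ) :=
  (2⁻¹ : ℝ) • shift 1 p + (2⁻¹ : ℝ) • shift (-1) p - shift 0 p

theorem coeff_midpointDefect (w : List (σ ⊕ σ)) (p : FreeAlgebra ℝ σ) :
    coeff w (midpointDefect p) =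
      (2⁻¹ + 2⁻¹ * (-1) ^ w.countP Sum.isRight - 0 ^ w.countP Sum.isRight)
        * coeff (w.map (Sum.elim id id)) p := by
  simp only [midpointDefect, map_sub, map_add, map_smul, coeff_shift, smul_eq_mul]
  ring

theorem star_midpointDefect {p : FreeAlgebra ℝ σ} (hp : star p = p) :
    star (midpointDefect p) = midpointDefect p :=
  coeff_ext fun w => by
    rw [coeff_star, coeff_midpointDefect, coeff_midpointDefect, List.countP_reverse,
      List.map_reverse, ← coeff_star, hp]

variable {ι : Type*} [Fintype ι] {p : FreeAlgebra ℝ σ} {h : ι → FreeAlgebra ℝ (σ ⊕ σ)}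

theorem coeff_map_inl_midpointDefect (w : List σ) :
    coeff (w.map .inl) (midpointDefect p) = 0 := by
  have hcount : (w.map (Sum.inl : σ → σ ⊕ σ)).countP Sum.isRight = 0 := by
    simp [List.countP_eq_zero]
  rw [coeff_midpointDefect, hcount]
  norm_num

theorem coeff_map_inl_append_inr_inr_midpointDefect (u v : List σ) (a b : σ) :
    coeff (u.map .inl ++ .inr a :: .inr b :: v.map .inl) (midpointDefect p)
      = coeff (u ++ a :: b :: v) p := by
  have hcount : ∀ w : List σ, (w.map (Sum.inl : σ → σ ⊕ σ)).countP Sum.isRight = 0 := by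
    simp [List.countP_eq_zero]
  rw [coeff_midpointDefect]
  simp only [List.countP_append, hcount, List.countP_cons, List.map_append, List.map_cons,
    List.map_map, Sum.isRight_inr, Sum.elim_inr]
  norm_num

theorem mem_degreeLT_two_of_midpointDefect_eq (hsos : midpointDefect p = ∑ k, star (h k) * h k)
    (k : ι) : h k ∈ degreeLT ℝ (σ ⊕ σ) 2 := by
  refine mem_degreeLT_of_coeff_sum_star_mul_self (fun u hu hdeg => ?_) k
  obtain ⟨w, hw⟩ : ∃ w, w = u.map (Sum.elim id id) := ⟨_, rfl⟩
  have hlen : w.length = u.length := by simp [hw]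
  have hcoeff : ∀ v : List (σ ⊕ σ), v.length = w.length →
      coeff (w.reverse.map .inl ++ v) (midpointDefect p)
        = ∑ k, coeff (w.map .inl) (h k) * coeff v (h k) := fun v hv => by
    rw [hsos, List.map_reverse,
      coeff_append_sum_star_mul_self (by simpa using hv.symm) (by rwa [hv, hlen])]
  have hinl : ∀ k, coeff (w.map .inl) (h k) = 0 := by
    have hdiag := hcoeff (w.map .inl) (by simp)
    rw [← List.map_append, coeff_map_inl_midpointDefect, eq_comm,
      Finset.sum_mul_self_eq_zero_iff] at hdiag
    exact fun k => hdiag k (Finset.mem_univ k)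
  have hp : coeff (w.reverse ++ w) p = 0 := by
    rcases w with _ | ⟨a, _ | ⟨b, w'⟩⟩
    · exact absurd hu (by simp [← hlen])
    · exact absurd hu (by simp [← hlen])
    · rw [← coeff_map_inl_append_inr_inr_midpointDefect, hcoeff _ (by simp)]
      simp only [hinl, zero_mul, Finset.sum_const_zero]
  rw [← hsos, coeff_midpointDefect, List.map_append, List.map_reverse, ← hw, hp, mul_zero]

theorem coeff_eq_zero_of_midpointDefect_eq (hsos : midpointDefect p = ∑ k, star (h k) * h k)
    {w : List σ} (hw : 2 < w.length) : coeff w p = 0 := by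
  have hdeg := mem_degreeLT_two_of_midpointDefect_eq hsos
  have hmem : midpointDefect p ∈ degreeLT ℝ (σ ⊕ σ) (1 + 2) :=
    hsos ▸ sum_star_mul_self_mem_degreeLT hdeg
  match w, hw with
  | a :: b :: w', hw =>
    rw [← List.nil_append (a :: b :: w'), ← coeff_map_inl_append_inr_inr_midpointDefect]
    exact mem_degreeLT.1 hmem _ (by simpa [Nat.succ_le_iff] using hw)

theorem coeff_pair_of_midpointDefect_eq (hsos : midpointDefect p = ∑ k, star (h k) * h k)
    (i j : σ) : coeff [i, j] p = ∑ k, coeff [.inr i] (h k) * coeff [.inr j] (h k) := by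
  have hdeg := mem_degreeLT_two_of_midpointDefect_eq hsos
  rw [← coeff_append_sum_star_mul_self (u := [.inr i]) (v := [.inr j]) rfl hdeg, ← hsos]
  exact (coeff_map_inl_append_inr_inr_midpointDefect [] [] i j).symm

end MidpointDefect

section LinearForm

variable {R σ : Type*} [CommSemiring R] [Fintype σ]

/-- The linear polynomial `∑ c_j x_j`. -/
noncomputable def linearForm (c : σ → R) : FreeAlgebra R σ :=
  ∑ j, c j • FreeAlgebra.ι R j

theorem coeff_nil_linearForm (c : σ → R) : coeff [] (linearForm c) = 0 := by
  simp [coeff_nil, linearForm]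

theorem coeff_singleton_linearForm (c : σ → R) (i : σ) : coeff [i] (linearForm c) = c i := by
  classical
  simp [linearForm, coeff_ι]

theorem linearForm_mem_degreeLT_two (c : σ → R) : linearForm c ∈ degreeLT R σ 2 :=
  Submodule.sum_mem _ fun j _ => Submodule.smul_mem _ _ <| by
    simpa using word_mem_degreeLT (R := R) (w := [j]) (N := 2) (by simp)

theorem star_linearForm (c : σ → R) : star (linearForm c) = linearForm c := by
  simp [linearForm, star_sum, star_smul_free]

theorem lift_linearForm {A : Type*} [Semiring A] [Algebra R A] (X : σ → A) (c : σ → R) :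
    FreeAlgebra.lift R X (linearForm c) = ∑ j, c j • X j := by
  simp [linearForm]

end LinearForm

section Quadratic

variable {σ ι : Type*} [Fintype σ] [Fintype ι]

theorem coeff_nil_sum_star_mul_linearForm (s : ι → σ → ℝ) :
    coeff [] (∑ k, star (linearForm (s k)) * linearForm (s k)) = 0 := by
  simp [coeff_mul, coeff_nil_linearForm]

theorem coeff_singleton_sum_star_mul_linearForm (s : ι → σ → ℝ) (i : σ) :
    coeff [i] (∑ k, star (linearForm (s k)) * linearForm (s k)) = 0 := by
  simp [coeff_mul, Finset.sum_range_succ, coeff_nil_linearForm, star_linearForm]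

theorem coeff_pair_sum_star_mul_linearForm (s : ι → σ → ℝ) (i j : σ) :
    coeff [i, j] (∑ k, star (linearForm (s k)) * linearForm (s k)) = ∑ k, s k i * s k j := by
  have h := coeff_append_sum_star_mul_self (u := [i]) (v := [j]) rfl fun k =>
    linearForm_mem_degreeLT_two (s k)
  simpa only [coeff_singleton_linearForm] using! h

theorem sub_coeff_nil_eq_of_midpointDefect_eq {p : FreeAlgebra ℝ σ}
    {h : ι → FreeAlgebra ℝ (σ ⊕ σ)} (hsos : midpointDefect p = ∑ k, star (h k) * h k) :
    p - algebraMap ℝ _ (coeff [] p) = linearForm (fun i => coeff [i] p) +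
      ∑ k, star (linearForm fun i => coeff [.inr i] (h k)) *
        linearForm fun i => coeff [.inr i] (h k) := by
  classical
  have hlin := mem_degreeLT.1 (linearForm_mem_degreeLT_two fun i => coeff [i] p)
  have hquad := mem_degreeLT.1 <| sum_star_mul_self_mem_degreeLT (N := 1) fun k =>
    linearForm_mem_degreeLT_two fun i => coeff [Sum.inr i] (h k)
  refine coeff_ext fun w => ?_
  rw [Algebra.algebraMap_eq_smul_one, map_sub, map_smul, map_add, coeff_one]
  match w with
  | [] => rw [coeff_nil_linearForm, coeff_nil_sum_star_mul_linearForm]; simp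
  | [i] => rw [coeff_singleton_linearForm, coeff_singleton_sum_star_mul_linearForm]; simp
  | [i, j] =>
    rw [hlin _ le_rfl, coeff_pair_sum_star_mul_linearForm, coeff_pair_of_midpointDefect_eq hsos]
    simp
  | i :: j :: l :: w =>
    rw [hlin _ (by simp), hquad _ (by simp), coeff_eq_zero_of_midpointDefect_eq hsos (by simp)]
    simp

end Quadratic

section Finsler

theorem eventually_forall_add_mul_pos {α : Type*} [TopologicalSpace α] {K : Set α}
    (hK : IsCompact K) {f g : α → ℝ} (hf : Continuous f) (hg : Continuous g)
    (hg0 : ∀ x, 0 ≤ g x) (hpos : ∀ x ∈ K, g x = 0 → 0 < f x) :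
    ∀ᶠ M : ℝ in atTop, ∀ x ∈ K, 0 < f x + M * g x := by
  obtain ⟨n, hn⟩ := hK.elim_directed_cover (fun n : ℕ => {x | 0 < f x + n * g x})
    (fun n => isOpen_lt continuous_const (by fun_prop))
    (fun x hx => by
      rw [mem_iUnion]
      rcases (hg0 x).eq_or_lt with h0 | h0
      · exact ⟨0, by simpa using hpos x hx h0.symm⟩
      · obtain ⟨n, hn⟩ := exists_nat_gt (-f x / g x)
        exact ⟨n, by simpa using neg_lt_iff_pos_add'.1 ((div_lt_iff₀ h0).1 hn)⟩)
    (Monotone.directed_le fun m n hmn x (hx : 0 < f x + m * g x) =>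
      hx.trans_le (by have := hg0 x; gcongr))
  filter_upwards [eventually_ge_atTop (n : ℝ)] with M hM x hx
  exact (hn hx : 0 < f x + n * g x).trans_le (by have := hg0 x; gcongr)

variable {κ ι : Type*} [Fintype κ]

/- Finsler's lemma, by compactness of the unit sphere. -/
theorem eventually_posDef_add_smul_transpose_mul [Fintype ι] {B : Matrix κ κ ℝ} (hB : B.IsSymm)
    (W : Matrix ι κ ℝ) (hpos : ∀ x, x ≠ 0 → W *ᵥ x = 0 → 0 < x ⬝ᵥ (B *ᵥ x)) :
    ∀ᶠ M : ℝ in atTop, (B + M • (Wᵀ * W)).PosDef := by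
  have hquad : ∀ (M : ℝ) x, x ⬝ᵥ ((B + M • (Wᵀ * W)) *ᵥ x)
      = x ⬝ᵥ (B *ᵥ x) + M * ((W *ᵥ x) ⬝ᵥ (W *ᵥ x)) := fun M x => by
    rw [add_mulVec, dotProduct_add, smul_mulVec, dotProduct_smul, smul_eq_mul, ← mulVec_mulVec,
      dotProduct_mulVec x Wᵀ, vecMul_transpose]
  filter_upwards [eventually_forall_add_mul_pos (isCompact_sphere (0 : κ → ℝ) 1)
    (f := fun x => x ⬝ᵥ (B *ᵥ x)) (g := fun x => (W *ᵥ x) ⬝ᵥ (W *ᵥ x)) (by fun_prop)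
    (by fun_prop) (fun x => by simpa using dotProduct_star_self_nonneg (W *ᵥ x))
    (fun x hx h0 => hpos x (fun h => by simp [h] at hx) (dotProduct_self_eq_zero.1 h0))] with M hM
  refine .of_dotProduct_mulVec_pos ?_ fun x hx => ?_
  · rw [IsHermitian, conjTranspose_eq_transpose_of_trivial, transpose_add, hB, transpose_smul,
      transpose_mul, transpose_transpose]
  · have hinv : 0 < ‖x‖⁻¹ := inv_pos.2 (norm_pos_iff.2 hx)
    have hsphere := hM (‖x‖⁻¹ • x) (by simp [norm_smul, hx])
    rw [← hquad, mulVec_smul, smul_dotProduct, dotProduct_smul, smul_eq_mul, smul_eq_mul] at hsphere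
    simpa using (mul_pos_iff_of_pos_left hinv).1 ((mul_pos_iff_of_pos_left hinv).1 hsphere)

/-- The matrix of `x ↦ (v ⬝ᵥ v) x - (v ⬝ᵥ x) v`; its kernel is spanned by `v`. -/
def rejection [DecidableEq κ] (v : κ → ℝ) : Matrix κ κ ℝ :=
  (v ⬝ᵥ v) • 1 - vecMulVec v v

theorem rejection_mulVec [DecidableEq κ] (v x : κ → ℝ) :
    rejection v *ᵥ x = (v ⬝ᵥ v) • x - (v ⬝ᵥ x) • v := by
  rw [rejection, sub_mulVec, smul_mulVec, one_mulVec, vecMulVec_mulVec, op_smul_eq_smul]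

theorem exists_dotProduct_mulVec_eq_and_posDef_sub [Finite ι] {P : ι → Matrix κ κ ℝ}
    (hP : ∀ i, (P i).IsSymm) {v : κ → ℝ} (hv : v ≠ 0) {a : ℝ}
    (ha : ∀ i, v ⬝ᵥ (P i *ᵥ v) < a) :
    ∃ A : Matrix κ κ ℝ, v ⬝ᵥ (A *ᵥ v) = a ∧ ∀ i, (A - P i).PosDef := by
  classical
  have hvv : v ⬝ᵥ v ≠ 0 := by simpa using hv
  let A (M : ℝ) : Matrix κ κ ℝ := (a / (v ⬝ᵥ v)) • 1 + M • ((rejection v)ᵀ * rejection v)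
  have hAv : ∀ M, v ⬝ᵥ (A M *ᵥ v) = a := fun M => by
    simp only [A, add_mulVec, smul_mulVec, one_mulVec, ← mulVec_mulVec, rejection_mulVec v v,
      sub_self, mulVec_zero, smul_zero, add_zero, dotProduct_smul, smul_eq_mul,
      div_mul_cancel₀ _ hvv]
  suffices h : ∀ᶠ M in atTop, ∀ i, (A M - P i).PosDef by
    obtain ⟨M, hM⟩ := h.exists
    exact ⟨A M, hAv M, hM⟩
  refine eventually_all.2 fun i => ?_
  have hsymm : ((a / (v ⬝ᵥ v)) • (1 : Matrix κ κ ℝ) - P i).IsSymm :=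
    (isSymm_one.smul _).sub (hP i)
  refine (eventually_posDef_add_smul_transpose_mul hsymm (rejection v) fun x hx hker => ?_).mono
    fun M hM => by simpa only [A, add_sub_right_comm] using hM
  have hxv : x = ((v ⬝ᵥ x) / (v ⬝ᵥ v)) • v := by
    rw [rejection_mulVec, sub_eq_zero] at hker
    rw [div_eq_inv_mul, mul_smul, ← hker, inv_smul_smul₀ hvv]
  obtain ⟨c, hc⟩ : ∃ c, c = v ⬝ᵥ x / (v ⬝ᵥ v) := ⟨_, rfl⟩
  rw [← hc] at hxv
  have hc0 : c ≠ 0 := fun h0 => hx (by rw [hxv, h0, zero_smul])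
  have hquad : x ⬝ᵥ (((a / (v ⬝ᵥ v)) • (1 : Matrix κ κ ℝ) - P i) *ᵥ x)
      = c ^ 2 * (a - v ⬝ᵥ (P i *ᵥ v)) := by
    rw [hxv, mulVec_smul, sub_mulVec, smul_mulVec, one_mulVec, smul_dotProduct, dotProduct_smul,
      dotProduct_sub, dotProduct_smul, smul_eq_mul, smul_eq_mul, smul_eq_mul, div_mul_cancel₀ _ hvv]
    ring
  rw [hquad]
  exact mul_pos (by positivity) (sub_pos.2 (ha i))

end Finsler

section QuadForm

variable {σ κ μ : Type*}

/-- The direct sum `X ⊕ Y` of two matrix tuples, as a tuple of block diagonal matrices. -/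
def directSum (X : σ → Matrix κ κ ℝ) (Y : σ → Matrix μ μ ℝ) (j : σ) : Matrix (κ ⊕ μ) (κ ⊕ μ) ℝ :=
  fromBlocks (X j) 0 0 (Y j)

theorem directSum_isSymm {X : σ → Matrix κ κ ℝ} {Y : σ → Matrix μ μ ℝ} (hX : ∀ j, (X j).IsSymm)
    (hY : ∀ j, (Y j).IsSymm) (j : σ) : (directSum X Y j).IsSymm :=
  (hX j).fromBlocks transpose_zero (hY j)

theorem midpoint_directSum (X X' : σ → Matrix κ κ ℝ) (Y Y' : σ → Matrix μ μ ℝ) :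
    midpoint ℝ (directSum X Y) (directSum X' Y')
      = directSum (midpoint ℝ X X') (midpoint ℝ Y Y') := by
  ext j : 1
  simp [directSum, midpoint_eq_smul_add, fromBlocks_add, fromBlocks_smul]

variable [Fintype κ] [DecidableEq κ] [Fintype μ] [DecidableEq μ]

/-- The quadratic form `⟨p(X) v, v⟩` of the matrix `p(X)`. -/
noncomputable def quadForm (p : FreeAlgebra ℝ σ) (X : σ → Matrix κ κ ℝ) (v : κ → ℝ) : ℝ :=
  v ⬝ᵥ (FreeAlgebra.lift ℝ X p *ᵥ v)

theorem quadForm_smul (p : FreeAlgebra ℝ σ) (X : σ → Matrix κ κ ℝ) (c : ℝ) (v : κ → ℝ) :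
    quadForm p X (c • v) = c ^ 2 * quadForm p X v := by
  rw [quadForm, mulVec_smul, smul_dotProduct, dotProduct_smul, smul_smul, ← sq, smul_eq_mul,
    ← quadForm]

theorem lift_directSum (X : σ → Matrix κ κ ℝ) (Y : σ → Matrix μ μ ℝ) (p : FreeAlgebra ℝ σ) :
    FreeAlgebra.lift ℝ (directSum X Y) p
      = fromBlocks (FreeAlgebra.lift ℝ X p) 0 0 (FreeAlgebra.lift ℝ Y p) := by
  induction p with
  | grade0 r => simp [Algebra.algebraMap_eq_smul_one, ← fromBlocks_one, fromBlocks_smul]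
  | grade1 j => simp [directSum]
  | mul a b ha hb => simp [ha, hb, fromBlocks_multiply]
  | add a b ha hb => simp [ha, hb, fromBlocks_add]

theorem quadForm_directSum (p : FreeAlgebra ℝ σ) (X : σ → Matrix κ κ ℝ) (Y : σ → Matrix μ μ ℝ)
    (v : κ → ℝ) (w : μ → ℝ) :
    quadForm p (directSum X Y) (Sum.elim v w) = quadForm p X v + quadForm p Y w := by
  simp [quadForm, lift_directSum, fromBlocks_mulVec]

theorem quadForm_midpointDefect (p : FreeAlgebra ℝ σ) (Z : σ ⊕ σ → Matrix κ κ ℝ) (v : κ → ℝ) :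
    quadForm (midpointDefect p) Z v
      = 2⁻¹ * (quadForm p (Z ∘ .inl + Z ∘ .inr) v + quadForm p (Z ∘ .inl - Z ∘ .inr) v)
        - quadForm p (Z ∘ .inl) v := by
  simp only [quadForm, midpointDefect, map_sub, map_add, map_smul, lift_shift, one_smul, neg_smul,
    zero_smul, add_zero, ← sub_eq_add_neg, sub_mulVec, add_mulVec, smul_mulVec, dotProduct_sub,
    dotProduct_add, dotProduct_smul, smul_eq_mul, mul_add]

end QuadForm

section Sublevel

variable {g : ℕ} {p : FreePoly g} {κ μ : Type*} [Fintype κ] [DecidableEq κ] [Fintype μ]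
  [DecidableEq μ]

theorem posDef_sub_lift_midpoint
    (hconv : ∀ (n : ℕ) (A : Matrix (Fin n) (Fin n) ℝ), A.PosDef → Convex ℝ (sublevel p A))
    {A : Matrix κ κ ℝ} (hA : A.PosDef)
    {X Y : Fin g → Matrix κ κ ℝ} (hX : ∀ j, (X j).IsSymm) (hY : ∀ j, (Y j).IsSymm)
    (hAX : (A - FreeAlgebra.lift ℝ X p).PosDef) (hAY : (A - FreeAlgebra.lift ℝ Y p).PosDef) :
    (A - FreeAlgebra.lift ℝ (midpoint ℝ X Y) p).PosDef := by
  let e := Fintype.equivFin κ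
  have hmem : ∀ {Z : Fin g → Matrix κ κ ℝ}, (∀ j, (Z j).IsSymm) →
      (A - FreeAlgebra.lift ℝ Z p).PosDef →
      (fun j => (Z j).submatrix e.symm e.symm) ∈ sublevel p (A.submatrix e.symm e.symm) :=
    fun {Z} hZ hAZ => ⟨fun j => (hZ j).submatrix _, by
      rw [eval, lift_reindex]
      exact hAZ.submatrix e.symm.injective⟩
  have hmid := ((hconv _ _ (hA.submatrix e.symm.injective)).midpoint_mem
    (hmem hX hAX) (hmem hY hAY)).2
  have hreindex : midpoint ℝ (fun j => (X j).submatrix e.symm e.symm)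
      (fun j => (Y j).submatrix e.symm e.symm)
      = fun j => (midpoint ℝ X Y j).submatrix e.symm e.symm := by
    ext j : 1
    simp [midpoint_eq_smul_add, submatrix_add, submatrix_smul]
  rw [hreindex, eval, lift_reindex] at hmid
  simpa [submatrix_sub] using hmid.submatrix e.injective

theorem quadForm_midpoint_lt (hp : Symmetric p)
    (hconv : ∀ (n : ℕ) (A : Matrix (Fin n) (Fin n) ℝ), A.PosDef → Convex ℝ (sublevel p A))
    {X Y : Fin g → Matrix κ κ ℝ} (hX : ∀ j, (X j).IsSymm) (hY : ∀ j, (Y j).IsSymm)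
    {v : κ → ℝ} {a : ℝ} (ha : 0 < a) (hXa : quadForm p X v < a) (hYa : quadForm p Y v < a) :
    quadForm p (midpoint ℝ X Y) v < a := by
  rcases eq_or_ne v 0 with rfl | hv
  · simpa [quadForm] using ha
  obtain ⟨A, hA, hApos⟩ := exists_dotProduct_mulVec_eq_and_posDef_sub
    (P := ![FreeAlgebra.lift ℝ X p, FreeAlgebra.lift ℝ Y p, 0]) (v := v) (a := a)
    (by simp [Fin.forall_fin_succ, lift_isSymm hX hp, lift_isSymm hY hp]) hv
    (by simpa [Fin.forall_fin_succ, ha] using ⟨hXa, hYa⟩)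
  have hmid := (posDef_sub_lift_midpoint hconv (by simpa using hApos 2) hX hY (hApos 0)
    (hApos 1)).dotProduct_mulVec_pos hv
  rw [star_trivial, sub_mulVec, dotProduct_sub, hA, ← quadForm] at hmid
  linarith

theorem quadForm_midpoint_le (hp : Symmetric p)
    (hconv : ∀ (n : ℕ) (A : Matrix (Fin n) (Fin n) ℝ), A.PosDef → Convex ℝ (sublevel p A))
    {X₀ : Fin g → Matrix μ μ ℝ} (hX₀ : ∀ j, (X₀ j).IsSymm) {v₀ : μ → ℝ}
    (hpos : 0 < quadForm p X₀ v₀)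
    {X Y : Fin g → Matrix κ κ ℝ} (hX : ∀ j, (X j).IsSymm) (hY : ∀ j, (Y j).IsSymm) (v : κ → ℝ) :
    2 * quadForm p (midpoint ℝ X Y) v ≤ quadForm p X v + quadForm p Y v := by
  /- `X ⊕ Y` and `Y ⊕ X` take the same value at `v ⊕ v`, and their midpoint is `Z ⊕ Z` with `Z` the
  midpoint of `X` and `Y`. The summand `X₀` only serves to make that common value positive. -/
  refine le_of_forall_gt fun a ha => ?_
  obtain ⟨N, hN⟩ := exists_nat_gt (-a / quadForm p X₀ v₀)
  rw [div_lt_iff₀ hpos, neg_lt_iff_pos_add'] at hN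
  have hblocks := quadForm_midpoint_lt hp hconv (X := directSum (directSum X Y) X₀)
    (Y := directSum (directSum Y X) X₀) (directSum_isSymm (directSum_isSymm hX hY) hX₀)
    (directSum_isSymm (directSum_isSymm hY hX) hX₀)
    (v := Sum.elim (Sum.elim v v) (√N • v₀)) hN
  simp only [midpoint_directSum, quadForm_directSum, quadForm_smul, Real.sq_sqrt N.cast_nonneg,
    midpoint_self, midpoint_comm Y X, add_lt_add_iff_right, ← two_mul] at hblocks
  exact hblocks ha (by rwa [add_comm])

theorem matrixPositive_midpointDefect (hp : Symmetric p)
    (hconv : ∀ (n : ℕ) (A : Matrix (Fin n) (Fin n) ℝ), A.PosDef → Convex ℝ (sublevel p A))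
    {X₀ : Fin g → Matrix μ μ ℝ} (hX₀ : ∀ j, (X₀ j).IsSymm) {v₀ : μ → ℝ}
    (hpos : 0 < quadForm p X₀ v₀) : MatrixPositive (midpointDefect p) := by
  refine fun n Z hZ => .of_dotProduct_mulVec_nonneg ?_ fun v => ?_
  · rw [IsHermitian, conjTranspose_eq_transpose_of_trivial]
    exact lift_isSymm hZ (star_midpointDefect hp)
  · rw [star_trivial, ← quadForm, quadForm_midpointDefect]
    have hmid := quadForm_midpoint_le hp hconv hX₀ hpos
      (X := Z ∘ .inl + Z ∘ .inr) (Y := Z ∘ .inl - Z ∘ .inr)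
      (fun j => (hZ _).add (hZ _)) (fun j => (hZ _).sub (hZ _)) v
    rw [midpoint_add_sub] at hmid
    linarith

end Sublevel

section Characterization

variable {g : ℕ} {p : FreePoly g}

theorem isLinear_iff : IsLinear p ↔ ∃ c, p = linearForm c := by
  rw [IsLinear, Submodule.mem_span_range_iff_exists_fun]
  simp only [linearForm, eq_comm]

theorem Symmetric.sub_algebraMap (hp : Symmetric p) (c : ℝ) :
    Symmetric (p - algebraMap ℝ (FreePoly g) c) := by
  rw [Symmetric, star_sub, FreeAlgebra.star_algebraMap, hp]

theorem constTerm_sub_algebraMap (p : FreePoly g) (c : ℝ) :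
    constTerm (p - algebraMap ℝ (FreePoly g) c) = constTerm p - c := by
  rw [constTerm, map_sub, AlgHom.commutes, ← constTerm, Algebra.algebraMap_self_apply]

theorem centered_sub_algebraMap (p : FreePoly g) (c : ℝ) :
    centered (p - algebraMap ℝ (FreePoly g) c) = centered p := by
  rw [centered, constTerm_sub_algebraMap, map_sub, centered, sub_sub_sub_cancel_right]

theorem sublevel_sub_algebraMap {n : ℕ} (p : FreePoly g) (c : ℝ) (A : Matrix (Fin n) (Fin n) ℝ) :
    sublevel (p - algebraMap ℝ (FreePoly g) c) A = sublevel p (A + c • 1) := by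
  have hlevel : ∀ X : Fin g → Matrix (Fin n) (Fin n) ℝ,
      A - eval (p - algebraMap ℝ (FreePoly g) c) X = A + c • 1 - eval p X := fun X => by
    rw [eval, map_sub, AlgHom.commutes, Algebra.algebraMap_eq_smul_one, ← eval, sub_sub_eq_add_sub]
  simp only [sublevel, hlevel]

theorem constTerm_centered (p : FreePoly g) : constTerm (centered p) = 0 := by
  rw [centered, constTerm_sub_algebraMap, sub_self]

theorem centered_eq_self (hp : constTerm p = 0) : centered p = p := by
  rw [centered, hp, map_zero, sub_zero]

theorem quadForm_zero {κ : Type*} [Fintype κ] [DecidableEq κ] (p : FreePoly g) (v : κ → ℝ) :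
    quadForm p 0 v = constTerm p * (v ⬝ᵥ v) := by
  have hlift := map_lift (Algebra.ofId ℝ (Matrix κ κ ℝ)) (0 : Fin g → ℝ) p
  rw [show Algebra.ofId ℝ (Matrix κ κ ℝ) ∘ (0 : Fin g → ℝ) = 0 from funext fun _ => map_zero _,
    ← constTerm, Algebra.ofId_apply, Algebra.algebraMap_eq_smul_one] at hlift
  rw [quadForm, ← hlift, smul_mulVec, one_mulVec, dotProduct_smul, smul_eq_mul]

/-- The convexity gap `t p(X) + (1 - t) p(Y) - p(t X + (1 - t) Y)`, as a linear map in `p`. -/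
noncomputable def convexityGap {n : ℕ} (X Y : Fin g → Matrix (Fin n) (Fin n) ℝ) (t : ℝ) :
    FreePoly g →ₗ[ℝ] Matrix (Fin n) (Fin n) ℝ :=
  t • (FreeAlgebra.lift ℝ X).toLinearMap + (1 - t) • (FreeAlgebra.lift ℝ Y).toLinearMap
    - (FreeAlgebra.lift ℝ (t • X + (1 - t) • Y)).toLinearMap

section Gap

variable {n : ℕ} (X Y : Fin g → Matrix (Fin n) (Fin n) ℝ) (t : ℝ)

theorem convexityGap_apply (p : FreePoly g) :
    convexityGap X Y t p = t • eval p X + (1 - t) • eval p Y - eval p (t • X + (1 - t) • Y) :=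
  rfl

theorem convexityGap_algebraMap (c : ℝ) : convexityGap X Y t (algebraMap ℝ _ c) = 0 := by
  simp only [convexityGap_apply, eval, AlgHom.commutes]
  module

theorem eval_linearForm_combination (c : Fin g → ℝ) :
    eval (linearForm c) (t • X + (1 - t) • Y)
      = t • eval (linearForm c) X + (1 - t) • eval (linearForm c) Y := by
  simp only [eval, lift_linearForm, Pi.add_apply, Pi.smul_apply, smul_add, Finset.sum_add_distrib,
    Finset.smul_sum, smul_comm (c _)]

theorem convexityGap_linearForm (c : Fin g → ℝ) : convexityGap X Y t (linearForm c) = 0 := by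
  rw [convexityGap_apply, eval_linearForm_combination, sub_self]

theorem convexityGap_star_mul_linearForm (c : Fin g → ℝ) :
    convexityGap X Y t (star (linearForm c) * linearForm c)
      = (t * (1 - t)) • (eval (linearForm c) X - eval (linearForm c) Y) ^ 2 := by
  have hmul : ∀ Z : Fin g → Matrix (Fin n) (Fin n) ℝ,
      eval (star (linearForm c) * linearForm c) Z = eval (linearForm c) Z * eval (linearForm c) Z :=
    fun Z => by rw [star_linearForm, eval, map_mul, ← eval]
  simp only [convexityGap_apply, hmul, eval_linearForm_combination, sq, mul_add, add_mul, mul_sub,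
    sub_mul, smul_mul_smul_comm]
  module

end Gap

theorem matrixConvex_of_isLinearPlusSumSqLinear (hp : Symmetric p)
    (h : IsLinearPlusSumSqLinear (centered p)) : MatrixConvex p := by
  refine ⟨hp, fun n X Y t hX hY ht0 ht1 => ?_⟩
  obtain ⟨l, m, s, hl, hs, hdecomp⟩ := h
  obtain ⟨c, rfl⟩ := isLinear_iff.1 hl
  choose d hd using fun k => isLinear_iff.1 (hs k)
  rw [centered, sub_eq_iff_eq_add] at hdecomp
  rw [← convexityGap_apply, hdecomp, map_add, map_add, convexityGap_algebraMap,
    convexityGap_linearForm, zero_add, add_zero, map_sum]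
  refine posSemidef_sum _ fun k _ => ?_
  have hsymm : (eval (linearForm (d k)) X - eval (linearForm (d k)) Y).IsHermitian := by
    rw [IsHermitian, conjTranspose_eq_transpose_of_trivial]
    exact (lift_isSymm hX (star_linearForm _)).sub (lift_isSymm hY (star_linearForm _))
  rw [hd, convexityGap_star_mul_linearForm, sq]
  nth_rw 1 [← hsymm.eq]
  exact (posSemidef_conjTranspose_mul_self _).smul (mul_nonneg ht0 (sub_nonneg.2 ht1))

theorem MatrixConvex.convex_sublevel (hp : MatrixConvex p) (n : ℕ)
    (A : Matrix (Fin n) (Fin n) ℝ) : Convex ℝ (sublevel p A) := by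
  rintro X ⟨hX, hXA⟩ Y ⟨hY, hYA⟩ a b ha hb hab
  obtain rfl : b = 1 - a := by linarith
  refine ⟨fun j => ((hX j).smul a).add ((hY j).smul (1 - a)), ?_⟩
  have hgap := hp.2 n X Y a hX hY ha (by linarith)
  have hsum : (a • (A - eval p X) + (1 - a) • (A - eval p Y)).PosDef := by
    rcases ha.eq_or_lt with rfl | ha'
    · simpa using hYA
    · exact (hXA.smul ha').add_posSemidef (hYA.posSemidef.smul hb)
  convert hsum.add_posSemidef hgap using 1
  module

theorem MatrixConvex.quasiConvex (hp : MatrixConvex p) (h0 : constTerm p = 0) : QuasiConvex p :=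
  ⟨hp.1, h0, fun n A _ => hp.convex_sublevel n A⟩

theorem isLinearPlusSumSqLinear_centered_of_convex_sublevel (hp : Symmetric p)
    (hconv : ∀ (n : ℕ) (A : Matrix (Fin n) (Fin n) ℝ), A.PosDef → Convex ℝ (sublevel p A))
    {n : ℕ} {X : Fin g → Matrix (Fin n) (Fin n) ℝ} (hX : ∀ j, (X j).IsSymm) {v : Fin n → ℝ}
    (hpos : 0 < quadForm p X v) : IsLinearPlusSumSqLinear (centered p) := by
  obtain ⟨m, h, hsos⟩ := (matrixPositive_midpointDefect hp hconv hX hpos).exists_sum_star_mul_self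
    (star_midpointDefect hp)
  exact ⟨_, m, _, isLinear_iff.2 ⟨_, rfl⟩, fun k => isLinear_iff.2 ⟨_, rfl⟩,
    (congrArg (p - algebraMap ℝ _ ·) (coeff_nil p).symm).trans
      (sub_coeff_nil_eq_of_midpointDefect_eq hsos)⟩

theorem isLinearPlusSumSqLinear_of_forall_isSymm_convex_sublevel (hp : Symmetric p)
    (hconv : ∀ (n : ℕ) (A : Matrix (Fin n) (Fin n) ℝ), A.IsSymm → Convex ℝ (sublevel p A)) :
    IsLinearPlusSumSqLinear (centered p) := by
  obtain ⟨q, hq⟩ : ∃ q, q = p - algebraMap ℝ (FreePoly g) (constTerm p - 1) := ⟨_, rfl⟩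
  have hqconst : constTerm q = 1 := by rw [hq, constTerm_sub_algebraMap, sub_sub_cancel]
  have hqpos : 0 < quadForm q (0 : Fin g → Matrix (Fin 1) (Fin 1) ℝ) 1 := by
    simp [quadForm_zero, hqconst]
  rw [← centered_sub_algebraMap p (constTerm p - 1), ← hq]
  refine isLinearPlusSumSqLinear_centered_of_convex_sublevel (hq ▸ hp.sub_algebraMap _)
    (fun n A hA => ?_) (fun _ => isSymm_zero) hqpos
  rw [hq, sublevel_sub_algebraMap]
  exact hconv n _ ((show A.IsSymm by simpa using! hA.isHermitian).add (isSymm_one.smul _))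

theorem isLinearPlusSumSqLinear_of_quasiConvex (hp : QuasiConvex p)
    (hsos : IsSumSq (-p) → p = 0) : IsLinearPlusSumSqLinear p := by
  by_cases hpos : ∃ (n : ℕ) (X : Fin g → Matrix (Fin n) (Fin n) ℝ) (v : Fin n → ℝ),
      (∀ j, (X j).IsSymm) ∧ 0 < quadForm p X v
  · obtain ⟨n, X, v, hX, hv⟩ := hpos
    exact centered_eq_self hp.2.1 ▸
      isLinearPlusSumSqLinear_centered_of_convex_sublevel hp.1 hp.2.2 hX hv
  · push Not at hpos
    have hneg : star (-p) = -p := by rw [star_neg, hp.1]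
    have hpsd : MatrixPositive (-p) := fun n X hX => by
      refine .of_dotProduct_mulVec_nonneg ?_ fun v => ?_
      · rw [IsHermitian, conjTranspose_eq_transpose_of_trivial]
        exact lift_isSymm hX hneg
      · rw [star_trivial, map_neg, neg_mulVec, dotProduct_neg, neg_nonneg]
        exact hpos n X v hX
    rw [hsos (hpsd.exists_sum_star_mul_self hneg)]
    exact ⟨0, 0, Fin.elim0, Submodule.zero_mem _, fun j => j.elim0, by simp⟩

theorem IsLinearPlusSumSqLinear.eq_zero_of_isSumSq_neg (hp : IsLinearPlusSumSqLinear p)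
    (hsos : IsSumSq (-p)) : p = 0 := by
  obtain ⟨l, m, s, hl, -, hdecomp⟩ := hp
  obtain ⟨c, rfl⟩ := isLinear_iff.1 hl
  obtain ⟨k, h, hneg⟩ := hsos
  have hsum : ∑ i, star (Sum.elim h s i) * Sum.elim h s i = -linearForm c := by
    rw [Fintype.sum_sum_type]
    simp only [Sum.elim_inl, Sum.elim_inr]
    rw [← hneg, hdecomp]
    abel
  have hzero := eq_zero_of_coeff_sum_star_mul_self (h := Sum.elim h s) fun u => by
    rw [hsum, map_neg, neg_eq_zero]
    rcases u with _ | ⟨a, u⟩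
    · exact coeff_nil_linearForm c
    · exact mem_degreeLT.1 (linearForm_mem_degreeLT_two c) _ (by simp; omega)
  rw [← neg_eq_zero, hneg]
  exact Finset.sum_eq_zero fun i _ => by
    rw [show h i = 0 from hzero (.inl i), mul_zero]

end Characterization

end FreePoly

open FreePoly in
theorem theorem1p2 (g : ℕ) (p : FreePoly g) (hp : FreePoly.Symmetric p) :
    List.TFAE [
      FreePoly.IsLinearPlusSumSqLinear (FreePoly.centered p),
      FreePoly.MatrixConvex p,
      ∀ (n : ℕ) (A : Matrix (Fin n) (Fin n) ℝ), A.IsSymm → Convex ℝ (FreePoly.sublevel p A),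
      FreePoly.QuasiConvex (FreePoly.centered p) ∧
        ¬ (-FreePoly.centered p ≠ 0 ∧ FreePoly.IsSumSq (-FreePoly.centered p))] := by
  have hcentered : FreePoly.centered (FreePoly.centered p) = FreePoly.centered p :=
    centered_eq_self (constTerm_centered p)
  tfae_have 1 → 2 := matrixConvex_of_isLinearPlusSumSqLinear hp
  tfae_have 2 → 3 := fun h n A _ => h.convex_sublevel n A
  tfae_have 3 → 1 := isLinearPlusSumSqLinear_of_forall_isSymm_convex_sublevel hp
  tfae_have 1 → 4 := fun h =>
    ⟨(matrixConvex_of_isLinearPlusSumSqLinear (hp.sub_algebraMap _)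
        (hcentered.symm ▸ h)).quasiConvex (constTerm_centered p),
      fun ⟨hne, hsos⟩ => hne (neg_eq_zero.2 (h.eq_zero_of_isSumSq_neg hsos))⟩
  tfae_have 4 → 1 := fun ⟨hquasi, hsos⟩ =>
    isLinearPlusSumSqLinear_of_quasiConvex hquasi fun h => by simpa [h] using hsos
  tfae_finish
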